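/- Lemma (cone invariance: $QA + A^TQ + aQ \preceq 0$). Let $A, Q \in \mathbb{R}^{n\times n}$, where $Q$ is symmetric and nonsingular with exactly one negative eigenvalue and $n-1$ positive eigenvalues (counted with multiplicity), and let $\mathcal{C} = \{x \in \mathbb{R}^n : x^TQx \le 0\}$ (a two-sided Lorenz cone with vertex at the origin). Then $\mathcal{C}$ is positively invariant for the continuous linear system $\dot{x}(t) = Ax(t)$, i.e. every solution $x : [0,\infty) \to \mathbb{R}^n$ with $x(0) \in \mathcal{C}$ satisfies $x(t) \in \mathcal{C}$ for all $t \ge 0$, if and only if there exists $a \in \mathbb{R}$ such that $QA + A^TQ + aQ$ is negative semidefinite. -/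

import Mathlib

open Matrix

/-- A trajectory on `[0, ∞)` of the continuous linear system `ẋ(t) = A x(t)`
(the derivative at `t = 0` is the one-sided one). -/
def IsTrajectory {n : ℕ} (A : Matrix (Fin n) (Fin n) ℝ) (x : ℝ → (Fin n → ℝ)) : Prop :=
  ∀ t : ℝ, 0 ≤ t → HasDerivWithinAt x (A *ᵥ x t) (Set.Ici 0) t

/-- `S` is a (positively) invariant set for the continuous system `ẋ(t) = A x(t)`:
`x(0) ∈ S` implies `x(t) ∈ S` for all `t ≥ 0`. -/
def IsInvariantSet {n : ℕ} (A : Matrix (Fin n) (Fin n) ℝ) (S : Set (Fin n → ℝ)) : Prop :=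
  ∀ x : ℝ → (Fin n → ℝ), IsTrajectory A x → x 0 ∈ S → ∀ t : ℝ, 0 ≤ t → x t ∈ S

/-- The numbers of positive, zero and negative eigenvalues (with multiplicity) of a real
symmetric matrix. -/
noncomputable def inertia {n : ℕ} (Q : Matrix (Fin n) (Fin n) ℝ) (hQ : Q.IsSymm) : ℕ × ℕ × ℕ :=
  let ev : Fin n → ℝ := Matrix.IsHermitian.eigenvalues
    (show Q.IsHermitian by rw [Matrix.IsHermitian, Matrix.conjTranspose_eq_transpose_of_trivial, hQ])
  ((Finset.univ.filter fun i => 0 < ev i).card,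
   (Finset.univ.filter fun i => ev i = 0).card,
   (Finset.univ.filter fun i => ev i < 0).card)

/-- The two-sided cone `{x ∈ ℝⁿ | xᵀ Q x ≤ 0}`. -/
def quadCone {n : ℕ} (Q : Matrix (Fin n) (Fin n) ℝ) : Set (Fin n → ℝ) :=
  {x | x ⬝ᵥ (Q *ᵥ x) ≤ 0}

/-- `M` is negative semidefinite. -/
def NegSemidef {n : ℕ} (M : Matrix (Fin n) (Fin n) ℝ) : Prop :=
  (-M).PosSemidef

/-!
The quantity to follow is `f t = x(t)ᵀ Q x(t)` along a trajectory; its derivative is `xᵀ M x` with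
`M = Q A + Aᵀ Q` (`IsTrajectory.hasDerivWithinAt_dotProduct_mulVec`).

If `M + a Q ⪯ 0`, then `f' ≤ -a f`, so `t ↦ e^{a t} f t` is antitone and `f` cannot become positive
once `f 0 ≤ 0`.

Conversely, invariance says that `f` stays nonpositive if it starts at `0`, so its derivative at
`0` is nonpositive. As every point is the initial value of a trajectory
(`exists_isTrajectory`), `xᵀ M x ≤ 0` whenever `xᵀ Q x = 0`. The multiplier `a` then comes
from the S-lemma with equality (`QuadraticMap.exists_add_mul_nonpos_of_null_nonpos`), which
requires `Q` to take both signs. Of the inertia of `Q` only this is needed: eigenvectors supply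
the two signs when `2 ≤ n`, and for `n = 1` a suitable `a` makes `M + a Q` vanish.
-/

/-! ### The S-lemma with an equality constraint -/

/-- If `p > 0 > r`, the polynomial `p + b s + r s ^ 2` has two roots whose product is `p / r`;
in particular they have opposite signs. -/
lemma exists_roots_of_pos_of_neg {p b r : ℝ} (hp : 0 < p) (hr : r < 0) :
    ∃ s t : ℝ, 0 < s ∧ t < 0 ∧ s * t * r = p ∧
      p + s * b + s * s * r = 0 ∧ p + t * b + t * t * r = 0 := by
  set d := √(b ^ 2 - 4 * p * r) with hd
  have hpr : p * r < 0 := mul_neg_of_pos_of_neg hp hr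
  have hd2 : d ^ 2 = b ^ 2 - 4 * p * r := Real.sq_sqrt (by nlinarith [sq_nonneg b])
  have hbd : |b| < d := by
    rw [hd]
    apply Real.lt_sqrt_of_sq_lt
    rw [sq_abs]
    linarith
  obtain ⟨h1, h2⟩ := abs_lt.mp hbd
  have hr0 : r ≠ 0 := hr.ne
  refine ⟨(-b - d) / (2 * r), (-b + d) / (2 * r), div_pos_of_neg_of_neg (by linarith)
    (by linarith), div_neg_of_pos_of_neg (by linarith) (by linarith), ?_, ?_, ?_⟩
  · field_simp
    linear_combination -hd2
  · field_simp
    linear_combination hd2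
  · field_simp
    linear_combination hd2

namespace QuadraticMap

variable {V : Type*} [AddCommGroup V] [Module ℝ V]

/-- Restricted to the line `x + s y`, the form `q` vanishes at two parameters of opposite sign;
eliminating the polar term from the two inequalities for `m` at these points gives the claim. -/
lemma mul_le_mul_of_null_nonpos {q m : QuadraticForm ℝ V} (h : ∀ v, q v = 0 → m v ≤ 0)
    {x y : V} (hx : 0 < q x) (hy : q y < 0) : m y * q x ≤ m x * q y := by
  obtain ⟨s, t, hs, ht, hst, h1, h2⟩ := exists_roots_of_pos_of_neg (b := polar q x y) hx hy
  have expand (f : QuadraticForm ℝ V) (u : ℝ) :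
      f (x + u • y) = f x + u * polar f x y + u * u * f y := by
    rw [QuadraticMap.map_add f, QuadraticMap.map_smul, polar_smul_right, smul_eq_mul, smul_eq_mul]
    ring
  have k1 := h (x + s • y) (by rw [expand]; exact h1)
  have k2 := h (x + t • y) (by rw [expand]; exact h2)
  rw [expand] at k1 k2
  have k3 := mul_nonpos_of_nonneg_of_nonpos (neg_nonneg.mpr ht.le) k1
  have k4 := mul_nonpos_of_nonneg_of_nonpos hs.le k2
  have k5 : (s - t) * (m x - s * t * m y) ≤ 0 := by linarith
  have k6 : m x - s * t * m y ≤ 0 := nonpos_of_mul_nonpos_right k5 (by linarith)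
  have k7 := mul_nonneg_of_nonpos_of_nonpos k6 hy.le
  have k8 : m y * q x = s * t * m y * q y := by rw [← hst]; ring
  linarith

/-- **S-lemma with equality**: if `q` takes both signs and `m ≤ 0` on the null cone of `q`, then
`m + a q ≤ 0` everywhere for some `a`. -/
theorem exists_add_mul_nonpos_of_null_nonpos {q m : QuadraticForm ℝ V}
    (h : ∀ v, q v = 0 → m v ≤ 0) (hpos : ∃ x, 0 < q x) (hneg : ∃ y, q y < 0) :
    ∃ a : ℝ, ∀ v, m v + a * q v ≤ 0 := by
  obtain ⟨x₀, hx₀⟩ := hpos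
  obtain ⟨y₀, hy₀⟩ := hneg
  have key : ∀ x y, 0 < q x → q y < 0 → -(m y / q y) ≤ -(m x / q x) := by
    intro x y hx hy
    rw [neg_le_neg_iff, div_le_iff₀ hx, div_mul_eq_mul_div, le_div_iff_of_neg hy]
    exact mul_le_mul_of_null_nonpos h hx hy
  -- `a` must lie above every `-m y / q y` with `q y < 0` and below every `-m x / q x`
  -- with `0 < q x`.
  set S : Set ℝ := (fun y ↦ -(m y / q y)) '' {y | q y < 0}
  have hS : S.Nonempty := ⟨_, y₀, hy₀, rfl⟩
  have hub : ∀ x, 0 < q x → -(m x / q x) ∈ upperBounds S := by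
    rintro x hx _ ⟨y, hy, rfl⟩
    exact key x y hx hy
  refine ⟨sSup S, fun v ↦ ?_⟩
  rcases lt_trichotomy (q v) 0 with hv | hv | hv
  · have hle : -(m v / q v) ≤ sSup S := le_csSup ⟨_, hub x₀ hx₀⟩ ⟨v, hv, rfl⟩
    have := mul_le_mul_of_nonpos_right hle hv.le
    rw [neg_mul, div_mul_cancel₀ _ hv.ne] at this
    linarith
  · simpa [hv] using h v hv
  · have hle : sSup S ≤ -(m v / q v) := csSup_le hS (hub v hv)
    have := mul_le_mul_of_nonneg_right hle hv.le
    rw [neg_mul, div_mul_cancel₀ _ hv.ne'] at this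
    linarith

end QuadraticMap

/-! ### Trajectories of a linear system -/

lemma HasDerivWithinAt.dotProduct {ι : Type*} [Fintype ι] {x y : ℝ → ι → ℝ} {x' y' : ι → ℝ}
    {s : Set ℝ} {t : ℝ} (hx : HasDerivWithinAt x x' s t) (hy : HasDerivWithinAt y y' s t) :
    HasDerivWithinAt (fun u ↦ x u ⬝ᵥ y u) (x' ⬝ᵥ y t + x t ⬝ᵥ y') s t := by
  have := HasDerivWithinAt.fun_sum (u := Finset.univ) fun i _ ↦
    (hasDerivWithinAt_pi.mp hx i).fun_mul (hasDerivWithinAt_pi.mp hy i)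
  simpa only [dotProduct, Finset.sum_add_distrib] using! this

lemma HasDerivWithinAt.mulVec {ι κ : Type*} [Fintype ι] [Fintype κ] (Q : Matrix ι κ ℝ)
    {x : ℝ → κ → ℝ} {x' : κ → ℝ} {s : Set ℝ} {t : ℝ} (hx : HasDerivWithinAt x x' s t) :
    HasDerivWithinAt (fun u ↦ Q *ᵥ x u) (Q *ᵥ x') s t :=
  (LinearMap.toContinuousLinearMap Q.mulVecLin).hasFDerivAt.comp_hasDerivWithinAt t hx

variable {n : ℕ}

lemma dotProduct_mul_add_transpose_mul_mulVec (A Q : Matrix (Fin n) (Fin n) ℝ) (x : Fin n → ℝ) :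
    x ⬝ᵥ ((Q * A + Aᵀ * Q) *ᵥ x) = (A *ᵥ x) ⬝ᵥ (Q *ᵥ x) + x ⬝ᵥ (Q *ᵥ (A *ᵥ x)) := by
  rw [add_mulVec, dotProduct_add, ← mulVec_mulVec, ← mulVec_mulVec, dotProduct_mulVec x Aᵀ,
    vecMul_transpose, add_comm]

lemma IsTrajectory.hasDerivWithinAt_dotProduct_mulVec {A : Matrix (Fin n) (Fin n) ℝ}
    {x : ℝ → Fin n → ℝ} (hx : IsTrajectory A x) (Q : Matrix (Fin n) (Fin n) ℝ) {t : ℝ}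
    (ht : 0 ≤ t) :
    HasDerivWithinAt (fun u ↦ x u ⬝ᵥ (Q *ᵥ x u)) (x t ⬝ᵥ ((Q * A + Aᵀ * Q) *ᵥ x t))
      (Set.Ici 0) t := by
  rw [dotProduct_mul_add_transpose_mul_mulVec]
  exact (hx t ht).dotProduct ((hx t ht).mulVec Q)

/-- The trajectory starting at `x₀` is `t ↦ exp (t A) x₀`. -/
lemma exists_isTrajectory (A : Matrix (Fin n) (Fin n) ℝ) (x₀ : Fin n → ℝ) :
    ∃ x, IsTrajectory A x ∧ x 0 = x₀ := by
  -- The exponential is taken in the normed algebra of continuous endomorphisms, since matrices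
  -- carry no global norm.
  let L : (Fin n → ℝ) →L[ℝ] (Fin n → ℝ) := LinearMap.toContinuousLinearMap A.mulVecLin
  refine ⟨fun t ↦ NormedSpace.exp (t • L) x₀, fun t _ ↦ ?_, by simp⟩
  have h := (hasDerivAt_exp_smul_const' (𝕂 := ℝ) L t).clm_apply (hasDerivAt_const t x₀)
  simpa [L] using h.hasDerivWithinAt (s := Set.Ici 0)

/-! ### Invariance of the cone -/

lemma isInvariantSet_quadCone_of_negSemidef {A Q : Matrix (Fin n) (Fin n) ℝ} {a : ℝ}
    (h : NegSemidef (Q * A + Aᵀ * Q + a • Q)) : IsInvariantSet A (quadCone Q) := by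
  intro x hx h0 t ht
  have hle (v : Fin n → ℝ) : v ⬝ᵥ ((Q * A + Aᵀ * Q) *ᵥ v) + a * (v ⬝ᵥ (Q *ᵥ v)) ≤ 0 := by
    have := Matrix.PosSemidef.dotProduct_mulVec_nonneg h v
    rw [neg_mulVec, dotProduct_neg, add_mulVec, dotProduct_add, smul_mulVec, dotProduct_smul,
      star_trivial, smul_eq_mul] at this
    linarith
  have hderiv (s : ℝ) (hs : 0 ≤ s) :=
    (((hasDerivAt_id s).const_mul a).exp.hasDerivWithinAt (s := Set.Ici 0)).fun_mul
      (hx.hasDerivWithinAt_dotProduct_mulVec Q hs)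
  have hanti := antitoneOn_of_hasDerivWithinAt_nonpos (convex_Ici 0)
    (fun s hs ↦ (hderiv s hs).continuousWithinAt)
    (fun s hs ↦ (hderiv s (interior_subset hs)).mono interior_subset) (fun s _ ↦ by
      have := mul_nonpos_of_nonneg_of_nonpos (Real.exp_pos (a * s)).le (hle (x s))
      simp only [id, mul_one]
      linarith)
  have hft := hanti Set.self_mem_Ici ht ht
  simp only [id, mul_zero, Real.exp_zero, one_mul] at hft
  exact nonpos_of_mul_nonpos_right (hft.trans h0) (Real.exp_pos (a * t))

lemma IsInvariantSet.dotProduct_mulVec_nonpos {A Q : Matrix (Fin n) (Fin n) ℝ}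
    (h : IsInvariantSet A (quadCone Q)) {v : Fin n → ℝ} (hv : v ⬝ᵥ (Q *ᵥ v) = 0) :
    v ⬝ᵥ ((Q * A + Aᵀ * Q) *ᵥ v) ≤ 0 := by
  obtain ⟨x, hx, rfl⟩ := exists_isTrajectory A v
  have hslope := hx.hasDerivWithinAt_dotProduct_mulVec Q le_rfl
  rw [hasDerivWithinAt_iff_tendsto_slope, Set.Ici_sdiff_left] at hslope
  refine le_of_tendsto hslope (eventually_mem_nhdsWithin.mono fun t (ht : 0 < t) ↦ ?_)
  rw [slope_def_field, hv, sub_zero, sub_zero]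
  exact div_nonpos_of_nonpos_of_nonneg (h x hx hv.le t ht.le) ht.le

/-- On a unit eigenvector of `Q` the quadratic form of `Q` takes the eigenvalue as its value. -/
lemma Matrix.IsHermitian.exists_dotProduct_mulVec_eq_eigenvalues {ι : Type*} [Fintype ι]
    [DecidableEq ι] {Q : Matrix ι ι ℝ} (hQ : Q.IsHermitian) (i : ι) :
    ∃ v : ι → ℝ, v ⬝ᵥ (Q *ᵥ v) = hQ.eigenvalues i :=
  ⟨_, by simpa using (hQ.eigenvalues_eq i).symm⟩

theorem mainTheorem9 (n : ℕ) (A Q : Matrix (Fin n) (Fin n) ℝ) (hQ : Q.IsSymm)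
    (hin : inertia Q hQ = (n - 1, 0, 1)) :
    IsInvariantSet A (quadCone Q) ↔
      ∃ a : ℝ, NegSemidef (Q * A + Aᵀ * Q + a • Q) := by
  refine ⟨fun h ↦ ?_, fun ⟨a, ha⟩ ↦ isInvariantSet_quadCone_of_negSemidef ha⟩
  have hQ' : Q.IsHermitian := by
    rw [Matrix.IsHermitian, Matrix.conjTranspose_eq_transpose_of_trivial, hQ]
  simp only [inertia, Prod.mk.injEq] at hin
  obtain ⟨hpos, -, hneg⟩ := hin
  obtain ⟨i, hi⟩ := Finset.card_pos.mp (hneg ▸ Nat.one_pos)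
  obtain ⟨y, hy⟩ := hQ'.exists_dotProduct_mulVec_eq_eigenvalues i
  have hy' : y ⬝ᵥ (Q *ᵥ y) < 0 := hy ▸ (Finset.mem_filter.mp hi).2
  have hn : 0 < n := i.pos
  obtain rfl | hn2 : n = 1 ∨ 0 < n - 1 := by omega
  · -- For `1 × 1` matrices `Q A + Aᵀ Q = 2 A₀₀ Q`.
    refine ⟨-2 * A 0 0, ?_⟩
    have : Q * A + Aᵀ * Q + (-2 * A 0 0) • Q = 0 := by
      ext i j
      fin_cases i
      fin_cases j
      simp [Matrix.mul_apply]
      ring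
    rw [this, NegSemidef, neg_zero]
    exact Matrix.PosSemidef.zero
  obtain ⟨j, hj⟩ := Finset.card_pos.mp (hpos ▸ hn2)
  obtain ⟨x, hx⟩ := hQ'.exists_dotProduct_mulVec_eq_eigenvalues j
  have hx' : 0 < x ⬝ᵥ (Q *ᵥ x) := hx ▸ (Finset.mem_filter.mp hj).2
  have hform (M : Matrix (Fin n) (Fin n) ℝ) (v : Fin n → ℝ) :
      M.toQuadraticForm' v = v ⬝ᵥ (M *ᵥ v) := by
    simp [Matrix.toQuadraticForm', Matrix.toLinearMap₂'_apply']
  obtain ⟨a, ha⟩ := QuadraticMap.exists_add_mul_nonpos_of_null_nonpos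
    (q := Q.toQuadraticForm') (m := (Q * A + Aᵀ * Q).toQuadraticForm')
    (fun v hv ↦ by
      rw [hform] at hv ⊢
      exact h.dotProduct_mulVec_nonpos hv)
    ⟨x, by rwa [hform]⟩ ⟨y, by rwa [hform]⟩
  refine ⟨a, Matrix.PosSemidef.of_dotProduct_mulVec_nonneg ?_ fun v ↦ ?_⟩
  · rw [Matrix.IsHermitian, Matrix.conjTranspose_eq_transpose_of_trivial]
    simp [Matrix.transpose_mul, hQ.eq, add_comm]
  · have := ha v
    rw [hform, hform] at this
    rw [neg_mulVec, dotProduct_neg, add_mulVec, dotProduct_add, smul_mulVec, dotProduct_smul,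
      star_trivial, smul_eq_mul]
    linarith
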